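/- A partition of $[n]=\{1,2,\dots,n\}$ into non-empty subsets (blocks) is called non-crossing if there are no $a<b<c<d$ in $[n]$ such that $a$ and $c$ lie in one block while $b$ and $d$ lie in a different block. Let $X_n^{(l)}$ denote the number of blocks of size $l$ in a non-crossing partition of $[n]$ chosen uniformly at random from all non-crossing partitions of $[n]$. **Theorem.** 1. For all integers $n\ge 1$ and $1\le l\le 2n-1$ (that is, whenever no denominator below vanishes), $$\mathbb{E}\,X_n^{(l)}=\frac{n}{2^{l+1}}\prod_{j=0}^{l}\Big(1+\frac{2-j}{2n-j}\Big).$$ 2. For every fixed integer $l\ge 1$, as $n\to\infty$, $$\operatorname{Var} X_n^{(l)}=\frac{n}{2^{2l+3}}\Big[2^{l+2}-(l-1)^2-2\Big]+O(1),$$ where the implied constant may depend on $l$. 3. For all fixed integers $k,l\ge 1$ with $k\ne l$, as $n\to\infty$, $$\operatorname{Cov}\big(X_n^{(k)},X_n^{(l)}\big)=-\frac{n}{2^{k+l+3}}\Big[2+(k-1)(l-1)\Big]+O(1),$$ where the implied constant may depend on $k$ and $l$. In particular, $\operatorname{Cov}(X_n^{(k)},X_n^{(l)})<0$ for all sufficiently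 large $n$ (depending on $k$ and $l$). -/

import Mathlib

open MeasureTheory ProbabilityTheory Filter Asymptotics

/-- A partition is non-crossing if there are no `a < b < c < d` such that `a` and `c` lie in one
block and `b` and `d` lie in a different block. -/
def Finpartition.IsNonCrossing {α : Type*} [LinearOrder α] {s : Finset α}
    (P : Finpartition s) : Prop :=
  ∀ A ∈ P.parts, ∀ B ∈ P.parts, A ≠ B →
    ¬ ∃ a b c d : α, a < b ∧ b < c ∧ c < d ∧ a ∈ A ∧ c ∈ A ∧ b ∈ B ∧ d ∈ B

/-- `NC n` is the set of all non-crossing partitions of `{1, …, n}`. -/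
def NC (n : ℕ) : Type :=
  {P : Finpartition (Finset.Icc 1 n) // P.IsNonCrossing}

namespace NC

noncomputable instance (n : ℕ) : Fintype (NC n) :=
  Fintype.ofInjective (fun P : NC n => P.1) Subtype.val_injective

/-- The partition into singletons is non-crossing. -/
instance (n : ℕ) : Nonempty (NC n) := by
  refine ⟨⟨⊥, ?_⟩⟩
  rintro A hA B - - ⟨a, b, c, d, hab, hbc, -, ha, hc, -, -⟩
  rw [Finpartition.mem_bot_iff] at hA
  obtain ⟨x, -, rfl⟩ := hA
  rw [Finset.mem_singleton] at ha hc
  omega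

instance (n : ℕ) : MeasurableSpace (NC n) := ⊤

instance (n : ℕ) : DiscreteMeasurableSpace (NC n) := ⟨fun _ => trivial⟩

/-- The law of a uniformly random non-crossing partition of `{1, …, n}`. -/
noncomputable def uniform (n : ℕ) : Measure (NC n) :=
  (PMF.uniformOfFintype (NC n)).toMeasure

instance (n : ℕ) : IsProbabilityMeasure (uniform n) :=
  inferInstanceAs (IsProbabilityMeasure (PMF.uniformOfFintype (NC n)).toMeasure)

/-- The number of blocks of size `l`. -/
def blockCount {n : ℕ} (l : ℕ) (P : NC n) : ℕ :=
  (P.1.parts.filter (fun B => B.card = l)).card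

/-- The number `X_n^{(l)}` of blocks of size `l` in a random non-crossing partition of
`{1, …, n}`, as a real random variable. -/
def X (n l : ℕ) : NC n → ℝ := fun P => (blockCount l P : ℝ)

end NC

/-!
Reading off, for each `i`, the size of the block whose least element is `i` (and `0` if there is
none) turns a non-crossing partition of `{1, …, n}` into a word of natural numbers with sum `n`, all
of whose initial segments of length `j` have sum at least `j`. This is a bijection
(`IsBallot.existsUnique`): the last non-zero letter determines a block, which is an interval of the
ground set, and removing it leaves a shorter word of the same kind. Appending a letter `0` gives a
word of length `n + 1` and sum `n`, and by the cycle lemma (`existsUnique_isDominating`) every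
cyclic word of this length and sum has exactly one rotation with the prefix property. Hence, for
every rotation-invariant statistic of words, its sum over non-crossing partitions is `1 / (n + 1)`
times its sum over *all* words of length `n + 1` and sum `n` (`NC.succ_mul_sum_word`).

The number of blocks of size `l ≥ 1` is the number of letters equal to `l`, so moments are found by
prescribing letters and counting the remaining words by stars and bars. There are
`(2n choose n) / (n + 1)` non-crossing partitions; together they have `(2n - l - 1 choose n - l)`
blocks of size `l`, and `n * (2n - k - l - 2 choose n - k - l)` ordered pairs of distinct blocks of
sizes `k` and `l`. Writing the quotients as products gives the exact mean (`NC.integral_X`) and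
mixed second moment (`NC.integral_X_mul`).

For the asymptotics, let `m = k + l`. The mean of `X_n^(l)` is `n / 2 ^ (l + 1)` times
`1 + (l + 1) (4 - l) / (4 n) + O(1 / n ^ 2)`, and the mean number of ordered pairs is
`n ^ 2 / 2 ^ (m + 2)` times `1 + (- m ^ 2 + 5 m + 2) / (4 n) + O(1 / n ^ 2)`. The quadratic terms
cancel in the covariance, and the difference of the first-order coefficients is
`- (2 + (k - 1) (l - 1)) / 2`. For `k = l` the mean itself is added, since a block also pairs with
itself.
-/

/-! ### Non-crossing partitions and ballot words -/

/-- `P` is the set of blocks of a non-crossing partition of `S`. An unbundled form of a non-crossing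
`Finpartition`, in which blocks can be added and removed without transport along equalities of the
ground set. -/
structure IsNCPart (S : Finset ℕ) (P : Finset (Finset ℕ)) : Prop where
  nonempty : ∀ B ∈ P, B.Nonempty
  subset : ∀ B ∈ P, B ⊆ S
  cover : ∀ x ∈ S, ∃ B ∈ P, x ∈ B
  disj : ∀ A ∈ P, ∀ B ∈ P, ∀ x, x ∈ A → x ∈ B → A = B
  nc : ∀ A ∈ P, ∀ B ∈ P, A ≠ B →
    ¬ ∃ a b c d : ℕ, a < b ∧ b < c ∧ c < d ∧ a ∈ A ∧ c ∈ A ∧ b ∈ B ∧ d ∈ B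

open Classical in
/-- The word of a family of blocks: its value at `i` is the size of the block whose least element
is `i`, and `0` if there is no such block. -/
noncomputable def blockWord (P : Finset (Finset ℕ)) (i : ℕ) : ℕ :=
  ∑ B ∈ P, if IsLeast (B : Set ℕ) i then B.card else 0

/-- A word supported on `S`, of total weight `|S|`, such that every initial segment of `S` has
weight at least its size. -/
structure IsBallot (S : Finset ℕ) (a : ℕ → ℕ) : Prop where
  zero : ∀ i, i ∉ S → a i = 0
  sum : ∑ i ∈ S, a i = S.card
  le : ∀ j, (S.filter (· < j)).card ≤ ∑ i ∈ S.filter (· < j), a i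

namespace IsNCPart

variable {S : Finset ℕ} {P : Finset (Finset ℕ)}

lemma exists_isLeast (h : IsNCPart S P) {B : Finset ℕ} (hB : B ∈ P) :
    ∃ i, IsLeast (B : Set ℕ) i :=
  ⟨_, B.isLeast_min' (h.nonempty B hB)⟩

lemma blockWord_eq_card (h : IsNCPart S P) {B : Finset ℕ} (hB : B ∈ P) {i : ℕ}
    (hi : IsLeast (B : Set ℕ) i) : blockWord P i = B.card := by
  rw [blockWord, Finset.sum_eq_single B, if_pos hi]
  · exact fun C hC hCB => if_neg fun hCi => hCB (h.disj C hC B hB i hCi.1 hi.1)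
  · exact fun h => absurd hB h

lemma exists_of_blockWord_ne_zero {i : ℕ} (hi : blockWord P i ≠ 0) :
    ∃ B ∈ P, IsLeast (B : Set ℕ) i := by
  obtain ⟨B, hB, hBi⟩ := Finset.exists_ne_zero_of_sum_ne_zero hi
  exact ⟨B, hB, by_contra fun hne => hBi (if_neg hne)⟩

lemma blockWord_pos (h : IsNCPart S P) {B : Finset ℕ} (hB : B ∈ P) {i : ℕ}
    (hi : IsLeast (B : Set ℕ) i) : 0 < blockWord P i := by
  rw [h.blockWord_eq_card hB hi]
  exact (h.nonempty B hB).card_pos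

open Classical in
/-- A block of size `c` contributes `c` at its least element. -/
lemma sum_blockWord (T : Finset ℕ) :
    ∑ i ∈ T, blockWord P i = ∑ B ∈ P, if ∃ i ∈ T, IsLeast (B : Set ℕ) i then B.card else 0 := by
  simp only [blockWord]
  rw [Finset.sum_comm]
  refine Finset.sum_congr rfl fun B hB => ?_
  split_ifs with hT
  · obtain ⟨i, hi, hBi⟩ := hT
    rw [Finset.sum_eq_single i]
    · simp [hBi]
    · intro j _ hj
      rw [if_neg]
      intro hBj
      exact hj (hBj.unique hBi)
    · exact fun h => absurd hi h
  · refine Finset.sum_eq_zero fun i hi => if_neg fun hBi => hT ⟨i, hi, hBi⟩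

lemma card_eq_sum (h : IsNCPart S P) (p : ℕ → Prop) [DecidablePred p] :
    (S.filter p).card = ∑ B ∈ P, (B.filter p).card := by
  classical
  rw [← Finset.card_biUnion]
  · congr 1
    ext x
    simp only [Finset.mem_filter, Finset.mem_biUnion]
    constructor
    · rintro ⟨hx, hp⟩
      obtain ⟨B, hB, hxB⟩ := h.cover x hx
      exact ⟨B, hB, hxB, hp⟩
    · rintro ⟨B, hB, hxB, hp⟩
      exact ⟨h.subset B hB hxB, hp⟩
  · intro A hA B hB hAB
    rw [Function.onFun, Finset.disjoint_left]
    intro x hxA hxB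
    exact hAB (h.disj A hA B hB x (Finset.mem_filter.1 hxA).1 (Finset.mem_filter.1 hxB).1)

/-- The blocks whose least element is below `j` cover all points below `j`. -/
lemma isBallot_blockWord (h : IsNCPart S P) : IsBallot S (blockWord P) where
  zero i hi := by
    by_contra hne
    obtain ⟨B, hB, hBi⟩ := exists_of_blockWord_ne_zero hne
    exact hi (h.subset B hB hBi.1)
  sum := by
    classical
    rw [sum_blockWord]
    have := h.card_eq_sum (fun _ => True)
    simp only [Finset.filter_true] at this
    rw [this]
    refine Finset.sum_congr rfl fun B hB => if_pos ?_
    obtain ⟨i, hi⟩ := h.exists_isLeast hB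
    exact ⟨i, h.subset B hB hi.1, hi⟩
  le j := by
    classical
    rw [sum_blockWord, h.card_eq_sum]
    refine Finset.sum_le_sum fun B hB => ?_
    split_ifs with hT
    · exact Finset.card_filter_le _ _
    · rw [Nat.le_zero, Finset.card_eq_zero, Finset.filter_eq_empty_iff]
      intro x hx hxj
      obtain ⟨i, hi⟩ := h.exists_isLeast hB
      exact hT ⟨i, Finset.mem_filter.2 ⟨h.subset B hB hi.1, (hi.2 hx).trans_lt hxj⟩, hi⟩

lemma card_filter_card_eq (h : IsNCPart S P) {l : ℕ} (hl : 1 ≤ l) :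
    (P.filter (fun B => B.card = l)).card = (S.filter (fun i => blockWord P i = l)).card := by
  refine Finset.card_bij (fun B hB => B.min' (h.nonempty B (Finset.mem_filter.1 hB).1)) ?_ ?_ ?_
  · intro B hB
    obtain ⟨hB, hc⟩ := Finset.mem_filter.1 hB
    have hm := B.isLeast_min' (h.nonempty B hB)
    exact Finset.mem_filter.2 ⟨h.subset B hB hm.1, (h.blockWord_eq_card hB hm).trans hc⟩
  · intro A hA B hB hAB
    have hA' := (Finset.mem_filter.1 hA).1
    have hB' := (Finset.mem_filter.1 hB).1
    refine h.disj A hA' B hB' _ (A.min'_mem (h.nonempty A hA')) ?_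
    rw [hAB]
    exact B.min'_mem _
  · intro i hi
    obtain ⟨hi, hc⟩ := Finset.mem_filter.1 hi
    obtain ⟨B, hB, hBi⟩ := exists_of_blockWord_ne_zero (P := P) (i := i) (by omega)
    refine ⟨B, Finset.mem_filter.2 ⟨hB, by rw [← h.blockWord_eq_card hB hBi, hc]⟩, ?_⟩
    exact (B.isLeast_min' (h.nonempty B hB)).unique hBi

lemma erase (h : IsNCPart S P) {B : Finset ℕ} (hB : B ∈ P) :
    IsNCPart (S \ B) (P.erase B) where
  nonempty A hA := h.nonempty A (Finset.mem_of_mem_erase hA)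
  subset A hA x hx := by
    rw [Finset.mem_erase] at hA
    exact Finset.mem_sdiff.2 ⟨h.subset A hA.2 hx, fun hxB => hA.1 (h.disj A hA.2 B hB x hx hxB)⟩
  cover x hx := by
    rw [Finset.mem_sdiff] at hx
    obtain ⟨A, hA, hxA⟩ := h.cover x hx.1
    refine ⟨A, Finset.mem_erase.2 ⟨?_, hA⟩, hxA⟩
    rintro rfl
    exact hx.2 hxA
  disj A hA C hC := h.disj A (Finset.mem_of_mem_erase hA) C (Finset.mem_of_mem_erase hC)
  nc A hA C hC := h.nc A (Finset.mem_of_mem_erase hA) C (Finset.mem_of_mem_erase hC)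

/-- Adding an interval of the ground set as a new block creates no crossing. -/
lemma insert_interval {B : Finset ℕ} (h : IsNCPart (S \ B) P) (hne : B.Nonempty) (hBS : B ⊆ S)
    (hconv : ∀ x ∈ B, ∀ z ∈ B, ∀ y ∈ S, x ≤ y → y ≤ z → y ∈ B) :
    IsNCPart S (insert B P) where
  nonempty A hA := by
    obtain rfl | hA := Finset.mem_insert.1 hA
    exacts [hne, h.nonempty A hA]
  subset A hA := by
    obtain rfl | hA := Finset.mem_insert.1 hA
    exacts [hBS, (h.subset A hA).trans Finset.sdiff_subset]
  cover x hx := by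
    by_cases hxB : x ∈ B
    · exact ⟨B, Finset.mem_insert_self _ _, hxB⟩
    · obtain ⟨A, hA, hxA⟩ := h.cover x (Finset.mem_sdiff.2 ⟨hx, hxB⟩)
      exact ⟨A, Finset.mem_insert_of_mem hA, hxA⟩
  disj A hA C hC x hxA hxC := by
    rcases Finset.mem_insert.1 hA with rfl | hA' <;> rcases Finset.mem_insert.1 hC with rfl | hC'
    · rfl
    · exact absurd hxA (Finset.mem_sdiff.1 (h.subset C hC' hxC)).2
    · exact absurd hxC (Finset.mem_sdiff.1 (h.subset A hA' hxA)).2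
    · exact h.disj A hA' C hC' x hxA hxC
  nc A hA C hC hAC := by
    rcases Finset.mem_insert.1 hA with rfl | hA' <;> rcases Finset.mem_insert.1 hC with rfl | hC'
    · exact absurd rfl hAC
    · rintro ⟨a, b, c, d, hab, hbc, hcd, ha, hc, hb, hd⟩
      have hb' := Finset.mem_sdiff.1 (h.subset C hC' hb)
      exact hb'.2 (hconv a ha c hc b hb'.1 hab.le hbc.le)
    · rintro ⟨a, b, c, d, hab, hbc, hcd, ha, hc, hb, hd⟩
      have hc' := Finset.mem_sdiff.1 (h.subset A hA' hc)
      exact hc'.2 (hconv b hb d hd c hc'.1 hbc.le hcd.le)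
    · exact h.nc A hA' C hC' hAC

lemma blockWord_insert {B : Finset ℕ} {m : ℕ} (h : IsNCPart (S \ B) P)
    (hm : IsLeast (B : Set ℕ) m) :
    blockWord (insert B P) = Function.update (blockWord P) m B.card := by
  classical
  have hB : B ∉ P := fun hB => (Finset.mem_sdiff.1 (h.subset B hB hm.1)).2 hm.1
  funext i
  have hexp : blockWord (insert B P) i
      = (if IsLeast (B : Set ℕ) i then B.card else 0) + blockWord P i := by
    simp only [blockWord]
    rw [Finset.sum_insert hB]
  rw [hexp]
  by_cases him : i = m
  · subst him
    rw [if_pos hm, Function.update_self,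
      h.isBallot_blockWord.zero i fun hi => (Finset.mem_sdiff.1 hi).2 hm.1, add_zero]
  · rw [if_neg fun hi => him (hi.unique hm), Function.update_of_ne him, zero_add]

lemma blockWord_erase (h : IsNCPart S P) {B : Finset ℕ} (hB : B ∈ P) {m : ℕ}
    (hm : IsLeast (B : Set ℕ) m) :
    blockWord (P.erase B) = Function.update (blockWord P) m 0 := by
  have h' := h.erase hB
  have := h'.blockWord_insert hm
  rw [Finset.insert_erase hB] at this
  rw [this, Function.update_idem, eq_comm, Function.update_eq_self_iff]
  exact (h'.isBallot_blockWord.zero m fun hi => (Finset.mem_sdiff.1 hi).2 hm.1).symm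

/-- The block with the largest least element is an interval of the ground set: a point inside its
range but outside it would belong to a block starting earlier, and the two would cross. -/
lemma mem_of_last (h : IsNCPart S P) {m : ℕ} (hlast : ∀ i, blockWord P i ≠ 0 → i ≤ m)
    {B : Finset ℕ} (hB : B ∈ P) (hm : IsLeast (B : Set ℕ) m) :
    ∀ x ∈ B, ∀ y ∈ S, m ≤ y → y ≤ x → y ∈ B := by
  intro x hx y hy hmy hyx
  by_contra hyB
  obtain ⟨D, hD, hyD⟩ := h.cover y hy
  have hDB : D ≠ B := by
    rintro rfl
    exact hyB hyD
  obtain ⟨d, hd⟩ := h.exists_isLeast hD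
  have hdm : d ≤ m := hlast d (h.blockWord_pos hD hd).ne'
  have h1 : d ≠ m := by
    rintro rfl
    exact hDB (h.disj D hD B hB d hd.1 hm.1)
  have h2 : m ≠ y := by
    rintro rfl
    exact hyB hm.1
  have h3 : y ≠ x := by
    rintro rfl
    exact hyB hx
  exact h.nc D hD B hB hDB ⟨d, m, y, x, lt_of_le_of_ne hdm h1, lt_of_le_of_ne hmy h2,
    lt_of_le_of_ne hyx h3, hd.1, hyD, hm.1, hx⟩

end IsNCPart

/-- A finite set has an initial segment of every size up to its own. -/
lemma exists_initial_segment (T : Finset ℕ) : ∀ s ≤ T.card,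
    ∃ B ⊆ T, B.card = s ∧ ∀ x ∈ B, ∀ y ∈ T, y ≤ x → y ∈ B := by
  intro s
  induction s with
  | zero => exact fun _ => ⟨∅, by simp, by simp, by simp⟩
  | succ s ih =>
    intro hs
    obtain ⟨B, hBT, hc, hB⟩ := ih (by omega)
    have hne : (T \ B).Nonempty := by
      rw [← Finset.card_pos, Finset.card_sdiff_of_subset hBT]
      omega
    have hm := (T \ B).isLeast_min' hne
    generalize (T \ B).min' hne = m at hm
    have hmT := Finset.mem_sdiff.1 hm.1
    refine ⟨insert m B, Finset.insert_subset hmT.1 hBT, by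
      rw [Finset.card_insert_of_notMem hmT.2, hc], ?_⟩
    intro x hx y hy hyx
    by_cases hyB : y ∈ B
    · exact Finset.mem_insert_of_mem hyB
    have hmy : m ≤ y := hm.2 (Finset.mem_coe.2 (Finset.mem_sdiff.2 ⟨hy, hyB⟩))
    obtain rfl | hx := Finset.mem_insert.1 hx
    · rw [le_antisymm hyx hmy]
      exact Finset.mem_insert_self _ _
    · exact absurd (hB x hx y hy hyx) hyB

lemma initial_segment_unique {T B C : Finset ℕ} (hBT : B ⊆ T) (hCT : C ⊆ T)
    (hB : ∀ x ∈ B, ∀ y ∈ T, y ≤ x → y ∈ B) (hC : ∀ x ∈ C, ∀ y ∈ T, y ≤ x → y ∈ C)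
    (hcard : B.card = C.card) : B = C := by
  by_cases hBC : B ⊆ C
  · exact Finset.eq_of_subset_of_card_le hBC hcard.ge
  · obtain ⟨x, hxB, hxC⟩ := Finset.not_subset.1 hBC
    refine (Finset.eq_of_subset_of_card_le (fun y hy => ?_) hcard.le).symm
    rcases le_total x y with hxy | hxy
    · exact absurd (hC y hy x (hBT hxB) hxy) hxC
    · exact hB x hxB y (hCT hy) hxy

/-- A ballot word comes from exactly one non-crossing partition: the last non-zero letter `a m`
forces the first `a m` points of `S` from `m` on to be a block, and removing this block leaves a
ballot word on a smaller set. -/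
theorem IsBallot.existsUnique {S : Finset ℕ} {a : ℕ → ℕ} (h : IsBallot S a) :
    ∃! P : Finset (Finset ℕ), IsNCPart S P ∧ blockWord P = a := by
  induction S using Finset.strongInduction generalizing a with
  | H S ih =>
  obtain rfl | hS := S.eq_empty_or_nonempty
  · refine ⟨∅, ⟨⟨by simp, by simp, by simp, by simp, by simp⟩, ?_⟩, ?_⟩
    · funext i
      simp [blockWord, h.zero i]
    · rintro Q ⟨hQ, -⟩
      refine Finset.eq_empty_of_forall_notMem fun B hB => ?_
      obtain ⟨x, hx⟩ := hQ.nonempty B hB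
      simpa using hQ.subset B hB hx
  have hne : (S.filter (fun i => a i ≠ 0)).Nonempty := by
    rw [Finset.nonempty_iff_ne_empty, Ne, Finset.filter_eq_empty_iff]
    intro h0
    have h1 := h.sum
    rw [Finset.sum_eq_zero fun i hi => not_not.1 (h0 hi)] at h1
    exact hS.card_pos.ne h1
  have hm := (S.filter (fun i => a i ≠ 0)).isGreatest_max' hne
  generalize (S.filter (fun i => a i ≠ 0)).max' hne = m at hm
  obtain ⟨hmS, ham⟩ := Finset.mem_filter.1 hm.1
  have hlast : ∀ i, a i ≠ 0 → i ≤ m := fun i hi =>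
    hm.2 (Finset.mem_coe.2 (Finset.mem_filter.2
      ⟨by by_contra hiS; exact hi (h.zero i hiS), hi⟩))
  -- No weight lies beyond `m`, so enough points of `S` remain from `m` on for a block of size `a m`.
  have hfilter : ∀ j, m < j → ∑ i ∈ S.filter (· < j), a i = S.card := by
    intro j hj
    rw [← h.sum, Finset.sum_filter]
    refine Finset.sum_congr rfl fun i _ => ?_
    split_ifs with hij
    · rfl
    · by_contra hne
      have := hlast i (Ne.symm hne)
      omega
  have hsplit : a m + ∑ i ∈ S.filter (· < m), a i = S.card := by
    rw [← hfilter (m + 1) (Nat.lt_succ_self m)]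
    have : S.filter (· < m + 1) = insert m (S.filter (· < m)) := by
      ext i
      simp only [Finset.mem_filter, Finset.mem_insert]
      constructor
      · rintro ⟨h1, h2⟩
        by_cases him : i = m
        exacts [Or.inl him, Or.inr ⟨h1, by omega⟩]
      · rintro (rfl | ⟨h1, h2⟩)
        exacts [⟨hmS, by omega⟩, ⟨h1, by omega⟩]
    rw [this, Finset.sum_insert (by simp)]
  set T := S.filter (fun i => m ≤ i) with hT
  have hTcard : (S.filter (· < m)).card + T.card = S.card := by
    rw [hT, ← Finset.card_filter_add_card_filter_not (s := S) (· < m)]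
    simp only [not_lt]
  have hle := h.le m
  obtain ⟨B, hBT, hBc, hBi⟩ := exists_initial_segment T (a m) (by omega)
  have hBS : B ⊆ S := hBT.trans (Finset.filter_subset _ _)
  have hBne : B.Nonempty := by
    rw [← Finset.card_pos]
    omega
  have hmB : m ∈ B := by
    obtain ⟨x, hx⟩ := hBne
    exact hBi x hx m (Finset.mem_filter.2 ⟨hmS, le_rfl⟩) (Finset.mem_filter.1 (hBT hx)).2
  have hBm : IsLeast (B : Set ℕ) m := ⟨hmB, fun x hx => (Finset.mem_filter.1 (hBT hx)).2⟩
  have hzero : ∀ x ∈ B, x ≠ m → a x = 0 := by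
    intro x hx hxm
    by_contra hax
    exact hxm (le_antisymm (hlast x hax) (hBm.2 hx))
  have hsumB : ∀ p : ℕ → Prop, ∀ [DecidablePred p],
      ∑ i ∈ (S \ B).filter p, Function.update a m 0 i +
        ∑ i ∈ B.filter p, a i = ∑ i ∈ S.filter p, a i := by
    intro p _
    rw [← Finset.sum_sdiff (Finset.filter_subset_filter p hBS)]
    congr 1
    refine Finset.sum_congr ?_ ?_
    · ext i
      simp only [Finset.mem_filter, Finset.mem_sdiff]
      tauto
    · intro i hi
      rw [Function.update_of_ne]
      rintro rfl
      simp [hmB, hmS] at hi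
  have hcardB : ∀ p : ℕ → Prop, ∀ [DecidablePred p],
      ((S \ B).filter p).card + (B.filter p).card = (S.filter p).card := by
    intro p _
    rw [← Finset.card_sdiff_add_card_eq_card (Finset.filter_subset_filter p hBS)]
    congr 2
    ext i
    simp only [Finset.mem_filter, Finset.mem_sdiff]
    tauto
  have hsumB' : ∑ i ∈ B, a i = a m := by
    rw [Finset.sum_eq_single m hzero (fun h => absurd hmB h)]
  have hballot : IsBallot (S \ B) (Function.update a m 0) := by
    refine ⟨?_, ?_, ?_⟩
    · intro i hi
      by_cases him : i = m
      · rw [him, Function.update_self]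
      · rw [Function.update_of_ne him]
        by_cases hiS : i ∈ S
        · exact hzero i (by
            by_contra hiB
            exact hi (Finset.mem_sdiff.2 ⟨hiS, hiB⟩)) him
        · exact h.zero i hiS
    · have h1 := hsumB (fun _ => True)
      have h2 := hcardB (fun _ => True)
      simp only [Finset.filter_true] at h1 h2
      have := h.sum
      omega
    · intro j
      have h1 := hsumB (· < j)
      have h2 := hcardB (· < j)
      have h3 := h.le j
      rcases le_or_gt j m with hj | hj
      · have h4 : B.filter (· < j) = ∅ := by
          rw [Finset.filter_eq_empty_iff]
          intro x hx hxj
          have := hBm.2 hx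
          omega
        rw [h4] at h1 h2
        simp only [Finset.sum_empty, Finset.card_empty] at h1 h2
        omega
      · have h4 : ∑ i ∈ B.filter (· < j), a i = a m := by
          rw [Finset.sum_eq_single m (fun x hx => hzero x (Finset.mem_filter.1 hx).1)]
          intro h
          exact absurd (Finset.mem_filter.2 ⟨hmB, hj⟩) h
        have h5 := hfilter j hj
        have h6 := Finset.card_le_card (Finset.filter_subset (· < j) (S \ B))
        have h7 := hcardB (fun _ => True)
        simp only [Finset.filter_true] at h7
        omega
  -- The block `B` is split off, and the remaining word comes from a unique partition of `S \ B`.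
  obtain ⟨P, ⟨hP, hw⟩, huniq⟩ := ih (S \ B)
    (Finset.sdiff_ssubset hBS hBne) hballot
  refine ⟨insert B P, ⟨hP.insert_interval hBne hBS ?_, ?_⟩, ?_⟩
  · intro x hx z hz y hy hxy hyz
    exact hBi z hz y (Finset.mem_filter.2 ⟨hy, (hBm.2 hx).trans hxy⟩) hyz
  · rw [hP.blockWord_insert hBm, hw, hBc, Function.update_idem, Function.update_eq_self]
  · -- In any other partition with this word, the block starting at `m` must be `B` as well.
    rintro Q ⟨hQ, rfl⟩
    obtain ⟨C, hC, hCm⟩ := IsNCPart.exists_of_blockWord_ne_zero ham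
    have hCT : C ⊆ T := fun x hx => Finset.mem_filter.2 ⟨hQ.subset C hC hx, hCm.2 hx⟩
    have hCB : C = B := by
      refine initial_segment_unique hCT hBT (fun x hx y hy hyx => ?_) hBi ?_
      · exact hQ.mem_of_last hlast hC hCm x hx y (Finset.mem_filter.1 hy).1
          (Finset.mem_filter.1 hy).2 hyx
      · rw [hBc, hQ.blockWord_eq_card hC hCm]
    subst hCB
    have := huniq (Q.erase C) ⟨hQ.erase hC, hQ.blockWord_erase hC hCm⟩
    rw [← this, Finset.insert_erase hC]

/-! ### The cycle lemma -/

/-- A sequence that drops by one over each period has exactly one starting point per period from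
which it stays weakly above its starting value for a whole period: the first place where it attains
its minimum. -/
lemma existsUnique_lt_forall_le_add {N : ℕ} (hN : 0 < N) {h : ℕ → ℤ}
    (hper : ∀ t, h (t + N) = h t - 1) :
    ∃! t, t < N ∧ ∀ j < N, h t ≤ h (t + j) := by
  -- The lexicographic order on `(h t, t)` singles out the first minimum.
  obtain ⟨t, ht, hmin⟩ := Finset.exists_min_image (Finset.range N)
    (fun t => toLex (h t, t)) ⟨0, Finset.mem_range.2 hN⟩
  simp only [Finset.mem_range, Prod.Lex.toLex_le_toLex] at ht hmin
  refine ⟨t, ⟨ht, fun j hj => ?_⟩, ?_⟩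
  · rcases lt_or_ge (t + j) N with hlt | hge
    · rcases hmin (t + j) hlt with h1 | h1
      exacts [h1.le, h1.1.le]
    · obtain ⟨s, hs⟩ := Nat.exists_eq_add_of_le' hge
      rw [hs, hper]
      rcases hmin s (by omega) with h1 | h1 <;> omega
  · rintro s ⟨hs, hs'⟩
    rcases lt_trichotomy s t with hst | rfl | hst
    · have h1 := hs' (t - s) (by omega)
      rw [Nat.add_sub_cancel' hst.le] at h1
      rcases hmin s hs with h2 | h2 <;> omega
    · rfl
    · have h1 := hs' (t + N - s) (by omega)
      rw [Nat.add_sub_cancel' (by omega), hper] at h1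
      rcases hmin s hs with h2 | h2 <;> omega

/-- A cyclic word whose first `j` letters have sum at least `j`, for all `j ≤ n`. -/
def IsDominating {n : ℕ} (b : ZMod (n + 1) → ℕ) : Prop :=
  ∀ j ≤ n, j ≤ ∑ i ∈ Finset.range j, b (i : ZMod (n + 1))

lemma ZMod.sum_range_natCast {n : ℕ} (b : ZMod (n + 1) → ℕ) :
    ∑ i ∈ Finset.range (n + 1), b (i : ZMod (n + 1)) = ∑ i, b i := by
  refine Finset.sum_nbij' (fun i => (i : ZMod (n + 1))) ZMod.val (by simp) ?_ ?_ (by simp) (by simp)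
  · exact fun i _ => Finset.mem_range.2 (ZMod.val_lt i)
  · exact fun i hi => ZMod.val_cast_of_lt (Finset.mem_range.1 hi)

/-- The cycle lemma: a cyclic word of length `n + 1` and sum `n` has exactly one dominating
rotation, which starts at the first minimum of the partial sums of the letters minus one. -/
lemma existsUnique_isDominating {n : ℕ} (b : ZMod (n + 1) → ℕ) (hb : ∑ i, b i = n) :
    ∃! r : ZMod (n + 1), IsDominating (fun i => b (i + r)) := by
  set h : ℕ → ℤ := fun t => ∑ i ∈ Finset.range t, (b (i : ZMod (n + 1)) : ℤ) - t with hh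
  have hadd : ∀ t j, h (t + j) = h t + ((∑ i ∈ Finset.range j, b (i + t : ZMod (n + 1)) : ℕ) : ℤ)
      - j := by
    intro t j
    simp only [hh]
    rw [Finset.sum_range_add]
    push_cast
    simp only [add_comm (t : ZMod (n + 1))]
    ring
  have hper : ∀ t, h (t + (n + 1)) = h t - 1 := by
    intro t
    have hrot : ∑ i, b (i + (t : ZMod (n + 1))) = n :=
      (Equiv.sum_comp (Equiv.addRight (t : ZMod (n + 1))) b).trans hb
    rw [hadd, ZMod.sum_range_natCast (fun i => b (i + (t : ZMod (n + 1)))), hrot]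
    push_cast
    ring
  have key : ∀ t : ℕ, IsDominating (fun i => b (i + (t : ZMod (n + 1)))) ↔
      ∀ j < n + 1, h t ≤ h (t + j) := by
    intro t
    simp only [IsDominating, Nat.lt_succ_iff]
    refine forall₂_congr fun j _ => ?_
    rw [hadd]
    omega
  obtain ⟨t, ⟨ht, htj⟩, huniq⟩ := existsUnique_lt_forall_le_add n.succ_pos hper
  refine ⟨t, (key t).2 htj, fun r hr => ?_⟩
  rw [← ZMod.natCast_zmod_val r] at hr
  rw [← huniq r.val ⟨ZMod.val_lt r, (key _).1 hr⟩, ZMod.natCast_zmod_val]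

open Classical in
/-- Summing a rotation-invariant function over all words of length `n + 1` and sum `n` counts each
dominating word `n + 1` times. -/
lemma sum_isDominating {n : ℕ} (f : (ZMod (n + 1) → ℕ) → ℕ)
    (hf : ∀ b r, f (fun i => b (i + r)) = f b) :
    (n + 1) * ∑ b ∈ (Finset.piAntidiag Finset.univ n).filter IsDominating, f b =
      ∑ b ∈ Finset.piAntidiag (Finset.univ : Finset (ZMod (n + 1))) n, f b := by
  symm
  calc ∑ b ∈ Finset.piAntidiag (Finset.univ : Finset (ZMod (n + 1))) n, f b
      = ∑ b ∈ Finset.piAntidiag (Finset.univ : Finset (ZMod (n + 1))) n,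
          ∑ r : ZMod (n + 1), if IsDominating (fun i => b (i + r)) then
            f (fun i => b (i + r)) else 0 := by
        refine Finset.sum_congr rfl fun b hb => ?_
        obtain ⟨r, hr, huniq⟩ := existsUnique_isDominating b (Finset.mem_piAntidiag.1 hb).1
        rw [Finset.sum_eq_single r, if_pos hr, hf]
        · exact fun s _ hs => if_neg fun h => hs (huniq s h)
        · exact fun h => absurd (Finset.mem_univ r) h
    _ = ∑ r : ZMod (n + 1), ∑ b ∈ (Finset.piAntidiag Finset.univ n).filter IsDominating, f b := by
        rw [Finset.sum_comm]
        refine Finset.sum_congr rfl fun r _ => ?_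
        rw [Finset.sum_filter]
        refine Finset.sum_nbij' (fun b i => b (i + r)) (fun b i => b (i - r)) ?_ ?_ ?_ ?_ ?_
        · intro b hb
          simp only [Finset.mem_piAntidiag, Finset.mem_univ, implies_true, and_true] at hb ⊢
          exact (Equiv.sum_comp (Equiv.addRight r) b).trans hb
        · intro b hb
          simp only [Finset.mem_piAntidiag, Finset.mem_univ, implies_true, and_true] at hb ⊢
          exact (Equiv.sum_comp (Equiv.subRight r) b).trans hb
        · intro b _
          simp
        · intro b _
          simp
        · intro b _
          rfl
    _ = _ := by
        rw [Finset.sum_const, Finset.card_univ, ZMod.card, smul_eq_mul]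

/-! ### Encoding non-crossing partitions by dominating words -/

lemma Finset.filter_lt_Icc_one (n j : ℕ) :
    (Finset.Icc 1 n).filter (· < j) = (Finset.range (min (j - 1) n)).image (· + 1) := by
  ext i
  simp only [Finset.mem_filter, Finset.mem_Icc, Finset.mem_image, Finset.mem_range]
  constructor
  · intro h
    exact ⟨i - 1, by omega, by omega⟩
  · rintro ⟨k, hk, rfl⟩
    omega

lemma Finset.sum_Icc_one (n : ℕ) (a : ℕ → ℕ) :
    ∑ i ∈ Finset.Icc 1 n, a i = ∑ i ∈ Finset.range n, a (i + 1) := by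
  have := Finset.filter_lt_Icc_one n (n + 1)
  rw [Finset.filter_true_of_mem (fun i hi => Nat.lt_succ_of_le (Finset.mem_Icc.1 hi).2)] at this
  rw [this, Finset.sum_image (by simp)]
  simp

lemma isBallot_Icc_one_iff {n : ℕ} {a : ℕ → ℕ} :
    IsBallot (Finset.Icc 1 n) a ↔ (∀ i ∉ Finset.Icc 1 n, a i = 0) ∧
      ∑ i ∈ Finset.range n, a (i + 1) = n ∧ ∀ j ≤ n, j ≤ ∑ i ∈ Finset.range j, a (i + 1) := by
  have hle : (∀ j, ((Finset.Icc 1 n).filter (· < j)).card ≤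
      ∑ i ∈ (Finset.Icc 1 n).filter (· < j), a i) ↔
      ∀ j ≤ n, j ≤ ∑ i ∈ Finset.range j, a (i + 1) := by
    have h1 : ∀ j, ((Finset.Icc 1 n).filter (· < j)).card = min (j - 1) n := fun j => by
      rw [Finset.filter_lt_Icc_one, Finset.card_image_of_injective _ (add_left_injective 1),
        Finset.card_range]
    have h2 : ∀ j, ∑ i ∈ (Finset.Icc 1 n).filter (· < j), a i =
        ∑ i ∈ Finset.range (min (j - 1) n), a (i + 1) := fun j => by
      rw [Finset.filter_lt_Icc_one, Finset.sum_image (by simp)]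
    simp only [h1, h2]
    constructor
    · intro h j hj
      simpa [hj] using h (j + 1)
    · exact fun h j => h _ (min_le_right _ _)
  constructor
  · intro h
    refine ⟨h.zero, ?_, hle.1 h.le⟩
    simpa [Finset.sum_Icc_one] using h.sum
  · rintro ⟨h1, h2, h3⟩
    exact ⟨h1, by simpa [Finset.sum_Icc_one] using h2, hle.2 h3⟩

namespace NC

lemma isNCPart {n : ℕ} (P : NC n) : IsNCPart (Finset.Icc 1 n) P.1.parts where
  nonempty _ hB := P.1.nonempty_of_mem_parts hB
  subset _ hB := P.1.subset hB
  cover _ hx := P.1.exists_mem hx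
  disj _ hA _ hB _ hxA hxB := P.1.eq_of_mem_parts hA hB hxA hxB
  nc := P.2

lemma exists_parts_eq {n : ℕ} {P : Finset (Finset ℕ)} (h : IsNCPart (Finset.Icc 1 n) P) :
    ∃ Q : NC n, Q.1.parts = P :=
  ⟨⟨Finpartition.ofExistsUnique P h.subset
      (fun x hx => by
        obtain ⟨B, hB, hxB⟩ := h.cover x hx
        exact ⟨B, ⟨hB, hxB⟩, fun C hC => h.disj C hC.1 B hB x hC.2 hxB⟩)
      (fun h0 => Finset.not_nonempty_empty (h.nonempty ∅ h0)), h.nc⟩, rfl⟩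

/-- The word of a non-crossing partition of `{1, …, n}`, read cyclically: the letter at `i` is the
size of the block with least element `i + 1`, and the letter at `n` is `0`. -/
noncomputable def word {n : ℕ} (P : NC n) (i : ZMod (n + 1)) : ℕ :=
  blockWord P.1.parts (i.val + 1)

lemma word_natCast {n : ℕ} (P : NC n) {i : ℕ} (hi : i ≤ n) :
    P.word (i : ZMod (n + 1)) = blockWord P.1.parts (i + 1) := by
  rw [word, ZMod.val_cast_of_lt (Nat.lt_succ_of_le hi)]

lemma word_last {n : ℕ} (P : NC n) : P.word (n : ZMod (n + 1)) = 0 := by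
  rw [P.word_natCast le_rfl]
  exact P.isNCPart.isBallot_blockWord.zero _ (by simp)

lemma sum_word {n : ℕ} (P : NC n) : ∑ i, P.word i = n := by
  rw [← ZMod.sum_range_natCast, Finset.sum_range_succ, word_last, add_zero]
  refine Eq.trans ?_ (isBallot_Icc_one_iff.1 P.isNCPart.isBallot_blockWord).2.1
  exact Finset.sum_congr rfl fun i hi => P.word_natCast (Finset.mem_range.1 hi).le

lemma isDominating_word {n : ℕ} (P : NC n) : IsDominating P.word := by
  intro j hj
  refine ((isBallot_Icc_one_iff.1 P.isNCPart.isBallot_blockWord).2.2 j hj).trans_eq ?_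
  exact Finset.sum_congr rfl fun i hi =>
    (P.word_natCast ((Finset.mem_range.1 hi).le.trans hj)).symm

lemma word_injective {n : ℕ} : Function.Injective (word (n := n)) := by
  intro P Q hPQ
  have hw : blockWord Q.1.parts = blockWord P.1.parts := by
    funext i
    by_cases hi : i ∈ Finset.Icc 1 n
    · have hi' := Finset.mem_Icc.1 hi
      obtain ⟨k, rfl⟩ := Nat.exists_eq_add_of_le' hi'.1
      rw [← Q.word_natCast (by omega), ← P.word_natCast (by omega), hPQ]
    · rw [P.isNCPart.isBallot_blockWord.zero i hi, Q.isNCPart.isBallot_blockWord.zero i hi]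
  exact Subtype.ext (Finpartition.ext (P.isNCPart.isBallot_blockWord.existsUnique.unique
    ⟨P.isNCPart, rfl⟩ ⟨Q.isNCPart, hw⟩))

lemma exists_word_eq {n : ℕ} {b : ZMod (n + 1) → ℕ} (hsum : ∑ i, b i = n)
    (hb : IsDominating b) : ∃ P : NC n, P.word = b := by
  set a : ℕ → ℕ := fun i => if i ∈ Finset.Icc 1 n then b ((i - 1 : ℕ) : ZMod (n + 1)) else 0
    with ha
  have ha' : ∀ i < n, a (i + 1) = b (i : ZMod (n + 1)) := by
    intro i hi
    rw [ha]
    simp [Nat.succ_le_of_lt hi]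
  have hpre : ∀ j ≤ n, ∑ i ∈ Finset.range j, a (i + 1) =
      ∑ i ∈ Finset.range j, b (i : ZMod (n + 1)) := fun j hj =>
    Finset.sum_congr rfl fun i hi => ha' i ((Finset.mem_range.1 hi).trans_le hj)
  have hsum' := hsum
  rw [← ZMod.sum_range_natCast, Finset.sum_range_succ] at hsum'
  have hn := hb n le_rfl
  have hballot : IsBallot (Finset.Icc 1 n) a := by
    refine isBallot_Icc_one_iff.2 ⟨fun i hi => if_neg hi, ?_, fun j hj => ?_⟩
    · rw [hpre n le_rfl]
      omega
    · rw [hpre j hj]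
      exact hb j hj
  obtain ⟨P, ⟨hP, hw⟩, -⟩ := hballot.existsUnique
  obtain ⟨Q, rfl⟩ := exists_parts_eq hP
  refine ⟨Q, funext fun i => ?_⟩
  have hi := ZMod.val_lt i
  rw [← ZMod.natCast_zmod_val i]
  rcases (Nat.lt_succ_iff.1 hi).lt_or_eq with hlt | heq
  · rw [Q.word_natCast hlt.le, hw, ha' _ hlt]
  · rw [heq, word_last]
    omega

open Classical in
lemma sum_word_eq {n : ℕ} (f : (ZMod (n + 1) → ℕ) → ℕ) :
    ∑ P : NC n, f P.word =
      ∑ b ∈ (Finset.piAntidiag Finset.univ n).filter IsDominating, f b := by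
  refine Finset.sum_bij (fun P _ => P.word) ?_ ?_ ?_ (fun _ _ => rfl)
  · intro P _
    exact Finset.mem_filter.2 ⟨Finset.mem_piAntidiag.2 ⟨P.sum_word, by simp⟩, P.isDominating_word⟩
  · exact fun P _ Q _ h => word_injective h
  · intro b hb
    obtain ⟨hb, hd⟩ := Finset.mem_filter.1 hb
    obtain ⟨P, hP⟩ := exists_word_eq (Finset.mem_piAntidiag.1 hb).1 hd
    exact ⟨P, Finset.mem_univ _, hP⟩

/-- Kreweras' enumeration in cyclic form: rotation-invariant statistics of the word of a
non-crossing partition are averages over all words of length `n + 1` and sum `n`. -/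
theorem succ_mul_sum_word {n : ℕ} (f : (ZMod (n + 1) → ℕ) → ℕ)
    (hf : ∀ b r, f (fun i => b (i + r)) = f b) :
    (n + 1) * ∑ P : NC n, f P.word =
      ∑ b ∈ Finset.piAntidiag (Finset.univ : Finset (ZMod (n + 1))) n, f b := by
  rw [sum_word_eq, sum_isDominating f hf]

/-- Blocks of size `l` correspond to letters equal to `l`. -/
lemma blockCount_eq {n l : ℕ} (hl : 1 ≤ l) (P : NC n) :
    blockCount l P = ∑ i, if P.word i = l then 1 else 0 := by
  have h1 : blockCount l P = _ := P.isNCPart.card_filter_card_eq hl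
  have hlast : ¬ P.word (n : ZMod (n + 1)) = l := by
    rw [word_last]
    omega
  rw [h1, Finset.card_filter, Finset.sum_Icc_one,
    ← ZMod.sum_range_natCast (fun i => if P.word i = l then 1 else 0),
    Finset.sum_range_succ, if_neg hlast, add_zero]
  exact Finset.sum_congr rfl fun i hi => by rw [P.word_natCast (Finset.mem_range.1 hi).le]

end NC

/-! ### Counting words with prescribed letters -/

/-- Stars and bars. -/
lemma card_piAntidiag_nat {ι : Type*} [DecidableEq ι] (s : Finset ι) (n : ℕ) :
    (Finset.piAntidiag s n).card = (s.card + n - 1).choose n := by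
  rw [← Finset.card_finsuppAntidiag_nat_eq_choose, Finset.finsuppAntidiag, Finset.card_map,
    Finset.card_attach]

/-- Prescribing the letter at `i` amounts to deleting that position. -/
lemma card_piAntidiag_filter_eq {ι : Type*} [DecidableEq ι] {s : Finset ι} {i : ι} (hi : i ∉ s)
    {n l : ℕ} (hl : l ≤ n) (q : (ι → ℕ) → Prop) [DecidablePred q]
    (hq : ∀ b x, q (Function.update b i x) ↔ q b) :
    ((Finset.piAntidiag (insert i s) n).filter (fun b => b i = l ∧ q b)).card =
      ((Finset.piAntidiag s (n - l)).filter q).card := by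
  have hupd : ∀ (b : ι → ℕ) x, ∑ j ∈ s, Function.update b i x j = ∑ j ∈ s, b j := fun b x =>
    Finset.sum_congr rfl fun j hj => Function.update_of_ne (fun h : j = i => hi (h ▸ hj)) _ _
  refine Finset.card_nbij' (fun b => Function.update b i 0) (fun b => Function.update b i l)
    ?_ ?_ ?_ ?_
  · intro b hb
    simp only [Finset.coe_filter, Finset.mem_piAntidiag, Set.mem_ofPred_eq,
      Finset.sum_insert hi, hupd, hq] at hb ⊢
    refine ⟨⟨by omega, fun j hj => ?_⟩, hb.2.2⟩
    have hji : j ≠ i := by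
      rintro rfl
      simp at hj
    rw [Function.update_of_ne hji] at hj
    exact Finset.mem_of_mem_insert_of_ne (hb.1.2 j hj) hji
  · intro b hb
    simp only [Finset.coe_filter, Finset.mem_piAntidiag, Set.mem_ofPred_eq,
      Finset.sum_insert hi, hupd, hq, Function.update_self, true_and] at hb ⊢
    refine ⟨⟨by rw [hb.1.1]; omega, fun j hj => ?_⟩, hb.2⟩
    by_cases hji : j = i
    · exact hji ▸ Finset.mem_insert_self _ _
    · rw [Function.update_of_ne hji] at hj
      exact Finset.mem_insert_of_mem (hb.1.2 j hj)
  · intro b hb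
    simp only [Finset.coe_filter, Set.mem_ofPred_eq] at hb
    simp only [Function.update_idem]
    rw [← hb.2.1, Function.update_eq_self]
  · intro b hb
    simp only [Finset.coe_filter, Finset.mem_piAntidiag, Set.mem_ofPred_eq] at hb
    simp only [Function.update_idem]
    rw [Function.update_eq_self_iff]
    by_contra h
    exact hi (hb.1.2 i (Ne.symm h))

lemma card_piAntidiag_filter_one {ι : Type*} [DecidableEq ι] [Fintype ι] (i : ι) {n l : ℕ}
    (hl : l ≤ n) :
    ((Finset.piAntidiag Finset.univ n).filter (fun b : ι → ℕ => b i = l)).card =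
      (Fintype.card ι - 1 + (n - l) - 1).choose (n - l) := by
  have h := card_piAntidiag_filter_eq (Finset.notMem_erase i Finset.univ) hl (fun _ => True)
    (by simp)
  rw [Finset.insert_erase (Finset.mem_univ i)] at h
  simpa [card_piAntidiag_nat] using h

lemma card_piAntidiag_filter_two {ι : Type*} [DecidableEq ι] [Fintype ι] {i j : ι} (hij : i ≠ j)
    {n k l : ℕ} (hl : k + l ≤ n) :
    ((Finset.piAntidiag Finset.univ n).filter (fun b : ι → ℕ => b i = k ∧ b j = l)).card =
      (Fintype.card ι - 2 + (n - k - l) - 1).choose (n - k - l) := by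
  have h := card_piAntidiag_filter_eq (Finset.notMem_erase i Finset.univ)
    (show k ≤ n by omega) (fun b : ι → ℕ => b j = l)
    (fun b x => by rw [Function.update_of_ne hij.symm])
  have hj : j ∈ Finset.univ.erase i := Finset.mem_erase.2 ⟨hij.symm, Finset.mem_univ j⟩
  have h' := card_piAntidiag_filter_eq (Finset.notMem_erase j (Finset.univ.erase i))
    (show l ≤ n - k by omega) (fun _ => True) (by simp)
  rw [Finset.insert_erase (Finset.mem_univ i)] at h
  rw [Finset.insert_erase hj] at h'
  rw [h]
  have hc : ((Finset.univ.erase i).erase j).card = Fintype.card ι - 2 := by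
    rw [Finset.card_erase_of_mem hj, Finset.card_erase_of_mem (Finset.mem_univ i),
      Finset.card_univ, Nat.sub_sub]
  simpa [card_piAntidiag_nat, hc] using h'

/-! ### Exact moments -/

namespace NC

lemma succ_mul_card (n : ℕ) : (n + 1) * Fintype.card (NC n) = (2 * n).choose n := by
  have h := succ_mul_sum_word (n := n) (fun _ => 1) (fun _ _ => rfl)
  simp only [Finset.sum_const, smul_eq_mul, mul_one, Finset.card_univ, card_piAntidiag_nat,
    ZMod.card] at h
  rw [h]
  congr 1
  omega

lemma sum_indicator_rotate {n : ℕ} (b : ZMod (n + 1) → ℕ) (r : ZMod (n + 1)) (l : ℕ) :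
    (∑ i, if b (i + r) = l then 1 else 0) = ∑ i, if b i = l then 1 else 0 :=
  Equiv.sum_comp (Equiv.addRight r) (fun i => if b i = l then 1 else 0)

/-- The `n + 1` positions of a letter `l` cancel the factor `n + 1` of the cycle lemma. -/
lemma sum_blockCount {n l : ℕ} (hl : 1 ≤ l) (hln : l ≤ n) :
    ∑ P : NC n, blockCount l P = (2 * n - l - 1).choose (n - l) := by
  have h := succ_mul_sum_word (n := n) (fun b => ∑ i, if b i = l then 1 else 0)
    (fun b r => sum_indicator_rotate b r l)
  simp only [← blockCount_eq hl] at h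
  rw [Finset.sum_comm] at h
  simp only [← Finset.card_filter, card_piAntidiag_filter_one _ hln, Finset.sum_const,
    Finset.card_univ, ZMod.card, smul_eq_mul] at h
  rw [Nat.eq_of_mul_eq_mul_left n.succ_pos h]
  congr 1
  omega

lemma blockCount_eq_zero {n l : ℕ} (hln : n < l) (P : NC n) : blockCount l P = 0 := by
  rw [blockCount, Finset.card_eq_zero, Finset.filter_eq_empty_iff]
  intro B hB hc
  have := Finset.card_le_card (P.1.subset hB)
  rw [Nat.card_Icc] at this
  omega

/-- The ordered pairs of distinct letters `k` and `l` in a word give the first summand; the second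
comes from pairing a letter with itself. -/
lemma sum_blockCount_mul {n k l : ℕ} (hk : 1 ≤ k) (hl : 1 ≤ l) (hkl : k + l ≤ n) :
    ∑ P : NC n, blockCount k P * blockCount l P =
      n * (2 * n - (k + l) - 2).choose (n - (k + l)) +
        if k = l then ∑ P : NC n, blockCount l P else 0 := by
  have h := succ_mul_sum_word (n := n)
    (fun b => (∑ i, if b i = k then 1 else 0) * ∑ i, if b i = l then 1 else 0)
    (fun b r => by rw [sum_indicator_rotate, sum_indicator_rotate])
  have h1 := succ_mul_sum_word (n := n) (fun b => ∑ i, if b i = l then 1 else 0)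
    (fun b r => sum_indicator_rotate b r l)
  simp only [← blockCount_eq hl, ← blockCount_eq hk] at h h1
  refine Nat.eq_of_mul_eq_mul_left n.succ_pos (h.trans ?_)
  simp only [Finset.sum_mul_sum]
  rw [Finset.sum_comm]
  have hrow : ∀ i : ZMod (n + 1),
      (∑ b ∈ Finset.piAntidiag (Finset.univ : Finset (ZMod (n + 1))) n,
        ∑ j, (if b i = k then 1 else 0) * (if b j = l then 1 else 0)) =
      n * (2 * n - (k + l) - 2).choose (n - (k + l)) +
        if k = l then ∑ b ∈ Finset.piAntidiag (Finset.univ : Finset (ZMod (n + 1))) n,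
          if b i = l then 1 else 0 else 0 := by
    intro i
    rw [Finset.sum_comm, ← Finset.sum_erase_add _ _ (Finset.mem_univ i)]
    congr 1
    · have hterm : ∀ j ∈ Finset.univ.erase i,
          (∑ b ∈ Finset.piAntidiag (Finset.univ : Finset (ZMod (n + 1))) n,
            (if b i = k then 1 else 0) * (if b j = l then 1 else 0)) =
          (2 * n - (k + l) - 2).choose (n - (k + l)) := by
        intro j hj
        have := card_piAntidiag_filter_two (Finset.ne_of_mem_erase hj).symm hkl
        rw [ZMod.card, Finset.card_filter] at this
        simp only [ite_and] at this
        simp only [ite_mul, one_mul, zero_mul]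
        rw [this, Nat.sub_sub n k l]
        congr 1
        omega
      rw [Finset.sum_congr rfl hterm, Finset.sum_const, Finset.card_erase_of_mem
        (Finset.mem_univ i), Finset.card_univ, ZMod.card, smul_eq_mul, Nat.add_sub_cancel]
    · split_ifs with hkl'
      · subst hkl'
        exact Finset.sum_congr rfl fun b _ => by split_ifs <;> rfl
      · refine Finset.sum_eq_zero fun b _ => ?_
        split_ifs <;> first | rfl | omega
  simp only [hrow, Finset.sum_add_distrib, Finset.sum_const, Finset.card_univ, ZMod.card,
    smul_eq_mul, mul_add]
  congr 1
  split_ifs with hkl'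
  · rw [h1, Finset.sum_comm]
  · simp

lemma integral_uniform (n : ℕ) (f : NC n → ℝ) :
    ∫ P, f P ∂(uniform n) = (∑ P, f P) / Fintype.card (NC n) := by
  rw [uniform, PMF.integral_eq_sum, Finset.sum_div]
  refine Finset.sum_congr rfl fun P _ => ?_
  simp [PMF.uniformOfFintype_apply, div_eq_inv_mul]

lemma cast_factorial_eq {n m : ℕ} (h : m ≤ n) :
    (n.factorial : ℝ) = (n - m).factorial * ∏ j ∈ Finset.range m, ((n : ℝ) - j) := by
  rw [← Nat.factorial_mul_descFactorial h, Nat.descFactorial_eq_prod_range]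
  push_cast
  congr 1
  refine Finset.prod_congr rfl fun j hj => ?_
  rw [Nat.cast_sub ((Finset.mem_range.1 hj).le.trans h)]

lemma cast_choose_mul {a b : ℕ} (h : b ≤ a) :
    (a.choose b : ℝ) * b.factorial * (a - b).factorial = a.factorial := by
  exact_mod_cast Nat.choose_mul_factorial_mul_factorial h

lemma prod_two_mul_sub_pos {n m : ℕ} (h : m ≤ 2 * n) :
    0 < ∏ j ∈ Finset.range m, (2 * (n : ℝ) - j) := by
  refine Finset.prod_pos fun j hj => ?_
  have : (j : ℝ) < 2 * n := by
    have := Finset.mem_range.1 hj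
    exact_mod_cast this.trans_le h
  linarith

lemma choose_two_mul_eq {n m : ℕ} (h : m ≤ 2 * n) :
    ((2 * n).choose n : ℝ) * n.factorial ^ 2 =
      (2 * n - m).factorial * ∏ j ∈ Finset.range m, (2 * (n : ℝ) - j) := by
  have h1 := cast_choose_mul (show n ≤ 2 * n by omega)
  have h2 := cast_factorial_eq h
  rw [show 2 * n - n = n by omega] at h1
  push_cast at h2
  rw [← h2, ← h1]
  ring

lemma card_eq (n : ℕ) : (Fintype.card (NC n) : ℝ) = (2 * n).choose n / (n + 1) := by
  rw [eq_div_iff (by positivity), mul_comm, ← succ_mul_card]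
  push_cast
  ring

lemma card_pos (n : ℕ) : (0 : ℝ) < Fintype.card (NC n) := by
  exact_mod_cast Fintype.card_pos

lemma integral_X_eq_prod {n l : ℕ} (hl : 1 ≤ l) (hln : l < 2 * n) :
    ∫ P, X n l P ∂(uniform n) =
      n * (∏ j ∈ Finset.range (l + 1), ((n : ℝ) + 1 - j)) /
        ∏ j ∈ Finset.range (l + 1), (2 * (n : ℝ) - j) := by
  have hshift : (∏ j ∈ Finset.range (l + 1), ((n : ℝ) + 1 - j)) =
      (n + 1) * ∏ j ∈ Finset.range l, ((n : ℝ) - j) := by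
    rw [Finset.prod_range_succ', mul_comm]
    simp
  have hpos := prod_two_mul_sub_pos (show l + 1 ≤ 2 * n by omega)
  rw [integral_uniform, hshift]
  simp only [X]
  rw [← Nat.cast_sum]
  rcases le_or_gt l n with h | h
  · rw [sum_blockCount hl h, div_eq_div_iff (card_pos n).ne' hpos.ne', card_eq]
    have h1 := cast_choose_mul (show n - l ≤ 2 * n - l - 1 by omega)
    rw [show 2 * n - l - 1 - (n - l) = n - 1 by omega] at h1
    have h2 := choose_two_mul_eq (show l + 1 ≤ 2 * n by omega)
    rw [← Nat.sub_sub] at h2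
    have h3 := cast_factorial_eq h
    have h4 : (n.factorial : ℝ) = n * (n - 1).factorial := by
      exact_mod_cast (Nat.mul_factorial_pred (by omega)).symm
    have h5 : ((n - l).factorial : ℝ) ≠ 0 := by positivity
    have h6 : ((n - 1).factorial : ℝ) ≠ 0 := by positivity
    rw [← h1, sq] at h2
    nth_rewrite 1 [h3] at h2
    rw [h4] at h2
    have h7 : (n : ℝ) + 1 ≠ 0 := by positivity
    have h8 : ((n - l).factorial * (n - 1).factorial : ℝ) ≠ 0 := mul_ne_zero h5 h6
    rw [mul_div_assoc', eq_div_iff h7]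
    refine mul_left_cancel₀ h8 ?_
    linear_combination -(n + 1 : ℝ) * h2
  · rw [Finset.sum_eq_zero fun P _ => blockCount_eq_zero h P,
      Finset.prod_eq_zero (Finset.mem_range.2 h) (sub_self _)]
    simp

theorem integral_X {n l : ℕ} (hl : 1 ≤ l) (hln : l < 2 * n) :
    ∫ P, X n l P ∂(uniform n) = (n : ℝ) / 2 ^ (l + 1) *
      ∏ j ∈ Finset.range (l + 1), (1 + (2 - (j : ℝ)) / (2 * (n : ℝ) - (j : ℝ))) := by
  have hterm : ∀ j ∈ Finset.range (l + 1), 1 + (2 - (j : ℝ)) / (2 * (n : ℝ) - (j : ℝ)) =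
      2 * (((n : ℝ) + 1 - j) / (2 * (n : ℝ) - j)) := by
    intro j hj
    have : (j : ℝ) < 2 * n := by
      have := Finset.mem_range.1 hj
      exact_mod_cast (show j < 2 * n by omega)
    have : 2 * (n : ℝ) - j ≠ 0 := by linarith
    field_simp
    ring
  rw [integral_X_eq_prod hl hln, Finset.prod_congr rfl hterm, Finset.prod_mul_distrib,
    Finset.prod_const, Finset.card_range, Finset.prod_div_distrib]
  field_simp

theorem integral_X_mul {n k l : ℕ} (hk : 1 ≤ k) (hl : 1 ≤ l) (hkl : k + l ≤ n) :
    ∫ P, X n k P * X n l P ∂(uniform n) =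
      n * ((n + 1) * n * (n - 1)) * (∏ j ∈ Finset.range (k + l), ((n : ℝ) - j)) /
        (∏ j ∈ Finset.range (k + l + 2), (2 * (n : ℝ) - j)) +
      if k = l then ∫ P, X n l P ∂(uniform n) else 0 := by
  have hpos := prod_two_mul_sub_pos (show k + l + 2 ≤ 2 * n by omega)
  have hmain : (n : ℝ) * (2 * n - (k + l) - 2).choose (n - (k + l)) / Fintype.card (NC n) =
      n * ((n + 1) * n * (n - 1)) * (∏ j ∈ Finset.range (k + l), ((n : ℝ) - j)) /
        ∏ j ∈ Finset.range (k + l + 2), (2 * (n : ℝ) - j) := by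
    rw [div_eq_div_iff (card_pos n).ne' hpos.ne', card_eq]
    have h1 := cast_choose_mul (show n - (k + l) ≤ 2 * n - (k + l) - 2 by omega)
    rw [show 2 * n - (k + l) - 2 - (n - (k + l)) = n - 2 by omega] at h1
    have h2 := choose_two_mul_eq (show k + l + 2 ≤ 2 * n by omega)
    rw [← Nat.sub_sub] at h2
    have h3 := cast_factorial_eq hkl
    have h4 : (n.factorial : ℝ) = n * ((n - 1) * (n - 2).factorial) := by
      obtain ⟨m, rfl⟩ := Nat.exists_eq_add_of_le' (show 2 ≤ n by omega)
      rw [Nat.factorial_succ, Nat.factorial_succ]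
      push_cast
      ring
    have h5 : ((n - (k + l)).factorial : ℝ) ≠ 0 := by positivity
    have h6 : ((n - 2).factorial : ℝ) ≠ 0 := by positivity
    rw [← h1, sq] at h2
    nth_rewrite 1 [h3] at h2
    rw [h4] at h2
    have h7 : (n : ℝ) + 1 ≠ 0 := by positivity
    have h8 : ((n - (k + l)).factorial * (n - 2).factorial : ℝ) ≠ 0 := mul_ne_zero h5 h6
    rw [mul_div_assoc', eq_div_iff h7]
    refine mul_left_cancel₀ h8 ?_
    linear_combination -(n * (n + 1) : ℝ) * h2
  rw [← hmain]
  simp only [integral_uniform, X, ← Nat.cast_mul, ← Nat.cast_sum, sum_blockCount_mul hk hl hkl]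
  split_ifs <;> push_cast <;> ring

lemma memLp_X (n l : ℕ) : MemLp (X n l) 2 (uniform n) := MemLp.of_discrete

end NC

/-! ### First-order expansions -/

/-- The sequence `f` satisfies `f n = 1 + a / n + O(1 / n ^ 2)` as `n → ∞`. -/
def HasExpansion (f : ℕ → ℝ) (a : ℝ) : Prop :=
  (fun n : ℕ => f n - 1 - a / n) =O[atTop] (fun n : ℕ => 1 / (n : ℝ) ^ 2)

namespace HasExpansion

lemma linear (a : ℝ) : HasExpansion (fun n => 1 + a / n) a := by
  refine (isBigO_zero _ _).congr_left fun n => ?_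
  ring

lemma one : HasExpansion (fun _ => 1) 0 := by
  simpa using linear 0

lemma congr {f g : ℕ → ℝ} {a : ℝ} (hf : HasExpansion f a) (hfg : f =ᶠ[atTop] g) :
    HasExpansion g a := by
  refine IsBigO.congr' hf ?_ EventuallyEq.rfl
  filter_upwards [hfg] with n hn
  rw [hn]

lemma div_isBigO_one (a : ℝ) : (fun n : ℕ => a / (n : ℝ)) =O[atTop] (fun _ : ℕ => (1 : ℝ)) :=
  (tendsto_const_div_atTop_nhds_zero_nat a).isBigO_one ℝ

lemma inv_sq_isBigO_one :
    (fun n : ℕ => 1 / (n : ℝ) ^ 2) =O[atTop] (fun _ : ℕ => (1 : ℝ)) := by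
  simpa [div_pow, sq] using (div_isBigO_one 1).mul (div_isBigO_one 1)

lemma isBigO_one {f : ℕ → ℝ} {a : ℝ} (hf : HasExpansion f a) :
    f =O[atTop] (fun _ : ℕ => (1 : ℝ)) := by
  have h := ((IsBigO.trans hf inv_sq_isBigO_one).add (isBigO_refl (fun _ : ℕ => (1 : ℝ)) atTop)).add
    (div_isBigO_one a)
  exact h.congr_left fun n => by ring

lemma mul {f g : ℕ → ℝ} {a b : ℝ} (hf : HasExpansion f a) (hg : HasExpansion g b) :
    HasExpansion (fun n => f n * g n) (a + b) := by
  have h1 := IsBigO.mul hf hg.isBigO_one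
  have h2 := IsBigO.mul (linear a).isBigO_one hg
  have h3 : (fun n : ℕ => a * b * (1 / (n : ℝ) ^ 2)) =O[atTop] (fun n : ℕ => 1 / (n : ℝ) ^ 2) :=
    (isBigO_refl _ _).const_mul_left _
  simp only [mul_one, one_mul] at h1 h2
  refine ((h1.add h2).add h3).congr_left fun n => ?_
  ring

lemma prod {F : ℕ → ℕ → ℝ} {a : ℕ → ℝ} (h : ∀ j, HasExpansion (F j) (a j)) (m : ℕ) :
    HasExpansion (fun n => ∏ j ∈ Finset.range m, F j n) (∑ j ∈ Finset.range m, a j) := by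
  induction m with
  | zero => simpa using one
  | succ m ih =>
    simp only [Finset.prod_range_succ, Finset.sum_range_succ]
    exact ih.mul (h m)

/-- The geometric series, to first order. -/
lemma inv_linear (c : ℝ) : HasExpansion (fun n => (1 - c / n)⁻¹) c := by
  have hlim : Tendsto (fun n : ℕ => (1 - c / (n : ℝ))) atTop (nhds 1) := by
    simpa using (tendsto_const_nhds (x := (1 : ℝ))).sub (tendsto_const_div_atTop_nhds_zero_nat c)
  have hinv : (fun n : ℕ => (1 - c / (n : ℝ))⁻¹) =O[atTop] (fun _ : ℕ => (1 : ℝ)) :=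
    (hlim.inv₀ one_ne_zero).isBigO_one ℝ
  have h : (fun n : ℕ => c ^ 2 * (1 / (n : ℝ) ^ 2) * (1 - c / (n : ℝ))⁻¹) =O[atTop]
      (fun n : ℕ => 1 / (n : ℝ) ^ 2 * 1) :=
    ((isBigO_refl _ _).const_mul_left _).mul hinv
  simp only [mul_one] at h
  refine IsBigO.congr' h ?_ EventuallyEq.rfl
  filter_upwards [hlim.eventually_ne one_ne_zero, eventually_gt_atTop 0] with n hn hn0
  have hn0' : (n : ℝ) ≠ 0 := by positivity
  have hn' : (n : ℝ) - c ≠ 0 := by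
    intro h0
    apply hn
    rw [← sub_eq_zero.1 h0, div_self hn0', sub_self]
  rw [show 1 - c / (n : ℝ) = (n - c) / n by field_simp]
  field_simp
  ring

end HasExpansion

/-! ### Asymptotics of the covariances -/

namespace NC

/-- The mean of `X n l`, divided by its leading term `n / 2 ^ (l + 1)`. -/
noncomputable def meanRatio (l n : ℕ) : ℝ :=
  ∏ j ∈ Finset.range (l + 1), (1 + (2 - (j : ℝ)) / (2 * (n : ℝ) - (j : ℝ)))

/-- The mean number of ordered pairs of distinct blocks whose given sizes add up to `m`, divided by
its leading term `n ^ 2 / 2 ^ (m + 2)`. -/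
noncomputable def pairRatio (m n : ℕ) : ℝ :=
  (1 + (-1) / (n : ℝ)) * (1 + 1 / (n : ℝ)) * (∏ j ∈ Finset.range m, (1 + (-(j : ℝ)) / (n : ℝ))) *
    ∏ j ∈ Finset.range (m + 2), (1 - ((j : ℝ) / 2) / (n : ℝ))⁻¹

lemma hasExpansion_meanRatio (l : ℕ) :
    HasExpansion (meanRatio l) (((l : ℝ) + 1) * (4 - l) / 4) := by
  have hfac : ∀ j : ℕ, HasExpansion
      (fun n => 1 + (2 - (j : ℝ)) / (2 * (n : ℝ) - (j : ℝ))) (1 - (j : ℝ) + (j : ℝ) / 2) := by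
    intro j
    refine ((HasExpansion.linear (1 - (j : ℝ))).mul
      (HasExpansion.inv_linear ((j : ℝ) / 2))).congr ?_
    filter_upwards [eventually_gt_atTop j] with n hn
    have hn0 : (0 : ℝ) < n := by exact_mod_cast (Nat.zero_le j).trans_lt hn
    have hj : (j : ℝ) < n := by exact_mod_cast hn
    have h2 : 2 * (n : ℝ) - j ≠ 0 := by linarith
    rw [show 1 - (j : ℝ) / 2 / n = (2 * n - j) / (2 * n) by field_simp, inv_div, one_add_div h2,
      one_add_div hn0.ne', div_mul_div_comm, div_eq_div_iff (mul_ne_zero hn0.ne' h2) h2]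
    ring
  have hsum : ∑ j ∈ Finset.range (l + 1), (1 - (j : ℝ) + (j : ℝ) / 2) =
      ((l : ℝ) + 1) * (4 - l) / 4 := by
    induction l with
    | zero => norm_num
    | succ l ih =>
      rw [Finset.sum_range_succ, ih]
      push_cast
      ring
  rw [← hsum]
  exact HasExpansion.prod hfac (l + 1)

lemma hasExpansion_pairRatio (m : ℕ) :
    HasExpansion (pairRatio m) ((-(m : ℝ) ^ 2 + 5 * m + 2) / 4) := by
  have h := (((HasExpansion.linear (-1)).mul (HasExpansion.linear 1)).mul
    (HasExpansion.prod (fun j : ℕ => HasExpansion.linear (-(j : ℝ))) m)).mul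
    (HasExpansion.prod (fun j : ℕ => HasExpansion.inv_linear ((j : ℝ) / 2)) (m + 2))
  have hsum : ∀ m : ℕ, -1 + 1 + ∑ j ∈ Finset.range m, -(j : ℝ) +
      ∑ j ∈ Finset.range (m + 2), (j : ℝ) / 2 = (-(m : ℝ) ^ 2 + 5 * m + 2) / 4 := by
    intro m
    induction m with
    | zero => norm_num [Finset.sum_range_succ]
    | succ m ih =>
      rw [Finset.sum_range_succ, show m + 1 + 2 = (m + 2) + 1 by ring,
        Finset.sum_range_succ _ (m + 2)]
      push_cast
      linear_combination ih
  rw [hsum] at h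
  exact h

lemma pair_eq_pairRatio {n m : ℕ} (hm : m < n) :
    (n : ℝ) * ((n + 1) * n * (n - 1)) * (∏ j ∈ Finset.range m, ((n : ℝ) - j)) /
      (∏ j ∈ Finset.range (m + 2), (2 * (n : ℝ) - j)) =
    (n : ℝ) ^ 2 / 2 ^ (m + 2) * pairRatio m n := by
  have hn0 : (n : ℝ) ≠ 0 := by
    have : 0 < n := by omega
    positivity
  have h1 : ∏ j ∈ Finset.range m, (1 + (-(j : ℝ)) / (n : ℝ)) =
      (∏ j ∈ Finset.range m, ((n : ℝ) - j)) / n ^ m := by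
    rw [← Finset.card_range m, ← Finset.prod_const, Finset.card_range, ← Finset.prod_div_distrib]
    refine Finset.prod_congr rfl fun j _ => ?_
    field_simp
    ring
  have h2 : ∏ j ∈ Finset.range (m + 2), (1 - ((j : ℝ) / 2) / (n : ℝ))⁻¹ =
      (2 * (n : ℝ)) ^ (m + 2) / ∏ j ∈ Finset.range (m + 2), (2 * (n : ℝ) - j) := by
    rw [← Finset.card_range (m + 2), ← Finset.prod_const, Finset.card_range,
      ← Finset.prod_div_distrib]
    refine Finset.prod_congr rfl fun j _ => ?_
    rw [show 1 - (j : ℝ) / 2 / n = (2 * n - j) / (2 * n) by field_simp, inv_div]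
  rw [pairRatio, h1, h2]
  have h3 := (prod_two_mul_sub_pos (show m + 2 ≤ 2 * n by omega)).ne'
  rw [mul_pow]
  field_simp
  ring

/-- The quadratic terms cancel, so only the first-order coefficients matter. -/
lemma sq_mul_sub_isBigO {f g : ℕ → ℝ} {a b : ℝ} (hf : HasExpansion f a) (hg : HasExpansion g b)
    (c : ℝ) : (fun n : ℕ => (n : ℝ) ^ 2 * c * (f n - g n) - n * c * (a - b)) =O[atTop]
      (fun _ : ℕ => (1 : ℝ)) := by
  have h := (isBigO_refl (fun n : ℕ => (n : ℝ) ^ 2 * c) atTop).mul (IsBigO.sub hf hg)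
  have hone : (fun n : ℕ => (n : ℝ) ^ 2 * c * (1 / (n : ℝ) ^ 2)) =O[atTop]
      (fun _ : ℕ => (1 : ℝ)) := by
    refine IsBigO.congr' (isBigO_const_const c (one_ne_zero (α := ℝ)) atTop) ?_ EventuallyEq.rfl
    filter_upwards [eventually_gt_atTop 0] with n hn
    field_simp
  refine IsBigO.congr' (h.trans hone) ?_ EventuallyEq.rfl
  filter_upwards [eventually_gt_atTop 0] with n hn
  field_simp
  ring

lemma mul_sub_isBigO {f : ℕ → ℝ} {a : ℝ} (hf : HasExpansion f a) (c : ℝ) :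
    (fun n : ℕ => (n : ℝ) * c * f n - n * c) =O[atTop] (fun _ : ℕ => (1 : ℝ)) := by
  have h := (isBigO_refl (fun n : ℕ => (n : ℝ) * c) atTop).mul hf
  have hone : (fun n : ℕ => (n : ℝ) * c * (1 / (n : ℝ) ^ 2)) =O[atTop]
      (fun _ : ℕ => (1 : ℝ)) := by
    refine IsBigO.congr' (HasExpansion.div_isBigO_one c) ?_ EventuallyEq.rfl
    filter_upwards [eventually_gt_atTop 0] with n hn
    field_simp
  refine IsBigO.congr' ((h.trans hone).add
    (isBigO_const_const (c * a) (one_ne_zero (α := ℝ)) atTop)) ?_ EventuallyEq.rfl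
  filter_upwards [eventually_gt_atTop 0] with n hn
  field_simp
  ring

lemma covariance_X_eq {n k l : ℕ} (hk : 1 ≤ k) (hl : 1 ≤ l) (hkl : k + l < n) :
    covariance (X n k) (X n l) (uniform n) =
      (n : ℝ) ^ 2 * (1 / 2 ^ (k + l + 2)) *
        (pairRatio (k + l) n - meanRatio k n * meanRatio l n) +
      if k = l then (n : ℝ) * (1 / 2 ^ (l + 1)) * meanRatio l n else 0 := by
  have hE : ∀ i, 1 ≤ i → i < n →
      ∫ P, X n i P ∂(uniform n) = (n : ℝ) / 2 ^ (i + 1) * meanRatio i n :=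
    fun i h1 h2 => integral_X h1 (by omega)
  rw [covariance_eq_sub (memLp_X n k) (memLp_X n l)]
  simp only [Pi.mul_apply]
  rw [integral_X_mul hk hl hkl.le, pair_eq_pairRatio hkl, hE k hk (by omega), hE l hl (by omega)]
  split_ifs <;> ring

theorem covariance_X_isBigO {k l : ℕ} (hk : 1 ≤ k) (hl : 1 ≤ l) :
    (fun n : ℕ => covariance (X n k) (X n l) (uniform n) -
      (-((n : ℝ) / 2 ^ (k + l + 3) * (2 + ((k : ℝ) - 1) * ((l : ℝ) - 1))) +
        if k = l then (n : ℝ) / 2 ^ (l + 1) else 0)) =O[atTop] (fun _ : ℕ => (1 : ℝ)) := by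
  have h1 := sq_mul_sub_isBigO (hasExpansion_pairRatio (k + l))
    ((hasExpansion_meanRatio k).mul (hasExpansion_meanRatio l)) (1 / 2 ^ (k + l + 2))
  have h2 : (fun n : ℕ => if k = l then (n : ℝ) * (1 / 2 ^ (l + 1)) * meanRatio l n -
      n * (1 / 2 ^ (l + 1)) else 0) =O[atTop] (fun _ : ℕ => (1 : ℝ)) := by
    split_ifs
    · exact mul_sub_isBigO (hasExpansion_meanRatio l) _
    · exact isBigO_zero _ _
  refine IsBigO.congr' (h1.add h2) ?_ EventuallyEq.rfl
  filter_upwards [eventually_gt_atTop (k + l)] with n hn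
  rw [covariance_X_eq hk hl hn, pow_succ _ (k + l + 2)]
  push_cast
  split_ifs <;> ring

end NC

theorem mainTheorem4 :
    (∀ n l : ℕ, 1 ≤ n → 1 ≤ l → l < 2 * n →
      ∫ P, NC.X n l P ∂(NC.uniform n) =
        (n : ℝ) / 2 ^ (l + 1) *
          ∏ j ∈ Finset.range (l + 1), (1 + (2 - (j : ℝ)) / (2 * (n : ℝ) - (j : ℝ)))) ∧
    (∀ l : ℕ, 1 ≤ l →
      (fun n : ℕ => variance (NC.X n l) (NC.uniform n) -
          (n : ℝ) / 2 ^ (2 * l + 3) * ((2 : ℝ) ^ (l + 2) - ((l : ℝ) - 1) ^ 2 - 2))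
        =O[atTop] (fun _ : ℕ => (1 : ℝ))) ∧
    (∀ k l : ℕ, 1 ≤ k → 1 ≤ l → k ≠ l →
      (fun n : ℕ => covariance (NC.X n k) (NC.X n l) (NC.uniform n) -
          (-((n : ℝ) / 2 ^ (k + l + 3) * (2 + ((k : ℝ) - 1) * ((l : ℝ) - 1)))))
        =O[atTop] (fun _ : ℕ => (1 : ℝ))) ∧
    (∀ k l : ℕ, 1 ≤ k → 1 ≤ l → k ≠ l →
      ∀ᶠ n : ℕ in atTop, covariance (NC.X n k) (NC.X n l) (NC.uniform n) < 0) := by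
  have hcov : ∀ k l : ℕ, 1 ≤ k → 1 ≤ l → k ≠ l →
      (fun n : ℕ => covariance (NC.X n k) (NC.X n l) (NC.uniform n) -
          (-((n : ℝ) / 2 ^ (k + l + 3) * (2 + ((k : ℝ) - 1) * ((l : ℝ) - 1)))))
        =O[atTop] (fun _ : ℕ => (1 : ℝ)) := by
    intro k l hk hl hkl
    simpa [hkl] using NC.covariance_X_isBigO hk hl
  refine ⟨fun n l _ hl hln => NC.integral_X hl hln, fun l hl => ?_, hcov, ?_⟩
  · refine (NC.covariance_X_isBigO hl hl).congr_left fun n => ?_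
    rw [covariance_self (NC.memLp_X n l).aestronglyMeasurable.aemeasurable, if_pos rfl,
      show 2 * l + 3 = (l + 1) + (l + 2) by ring, show l + l + 3 = (l + 1) + (l + 2) by ring,
      pow_add]
    field_simp
    ring
  · -- A negative linear term beats the bounded error.
    intro k l hk hl hkl
    obtain ⟨C, hC⟩ := (hcov k l hk hl hkl).bound
    have hk' : (1 : ℝ) ≤ k := by exact_mod_cast hk
    have hl' : (1 : ℝ) ≤ l := by exact_mod_cast hl
    have hpos : 0 < 1 / 2 ^ (k + l + 3) * (2 + ((k : ℝ) - 1) * ((l : ℝ) - 1)) := by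
      have := mul_nonneg (sub_nonneg.2 hk') (sub_nonneg.2 hl')
      positivity
    have hlim := (tendsto_natCast_atTop_atTop (R := ℝ)).atTop_mul_const hpos
    filter_upwards [hC, hlim.eventually_gt_atTop C] with n hn hn'
    rw [norm_one, mul_one, Real.norm_eq_abs] at hn
    have h1 := (abs_le.1 hn).2
    have h2 : (n : ℝ) / 2 ^ (k + l + 3) * (2 + ((k : ℝ) - 1) * ((l : ℝ) - 1)) =
        n * (1 / 2 ^ (k + l + 3) * (2 + ((k : ℝ) - 1) * ((l : ℝ) - 1))) := by ring
    linarith
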